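/- Let $(M,\phi,\xi,\eta,g)$ be a contact metric manifold of dimension $3$: $g$ is a Riemannian metric, $\phi$ a $(1,1)$-tensor field, $\xi$ a vector field and $\eta$ a $1$-form on $M$ (all smooth) with $$\eta(\xi)=1,\quad \phi^2X=-X+\eta(X)\xi,\quad g(\phi X,\phi Y)=g(X,Y)-\eta(X)\eta(Y),\quad d\eta(X,Y)=g(X,\phi Y),$$ where $d\eta(X,Y)=\tfrac12\{X\eta(Y)-Y\eta(X)-\eta([X,Y])\}$. Let $h=\tfrac12 L_\xi\phi$, and let $R(X,Y)Z=\nabla_X\nabla_YZ-\nabla_Y\nabla_XZ-\nabla_{[X,Y]}Z$ be the curvature tensor of the Levi-Civita connection $\nabla$ of $g$. Suppose that $M$ is a $(\kappa,\mu,\nu)$-contact metric manifold, i.e. that there are smooth functions $\kappa,\mu,\nu$ on $M$ with $$R(X,Y)\xi=\kappa\{\eta(Y)X-\eta(X)Y\}+\mu\{\eta(Y)hX-\eta(X)hY\}+\nu\{\eta(Y)\phi hX-\eta(X)\phi hY\}$$ for all vector fields $X,Y$, and suppose that $\kappa<1$ everywhere. Then the $\phi$-sectional curvature $g(R(X,\phi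 X)\phi X,X)$, for a unit vector $X\in T_pM$ orthogonal to $\xi_p$, depends only on $p$; denoting it by $F(p)$, one has $$R=F\,R_1+(F-\kappa)\,R_3+\mu\,R_4+\nu\,R_7,$$ where $$\begin{aligned} R_1(X,Y)Z&=g(Y,Z)X-g(X,Z)Y,\\ R_3(X,Y)Z&=\eta(X)\eta(Z)Y-\eta(Y)\eta(Z)X+g(X,Z)\eta(Y)\xi-g(Y,Z)\eta(X)\xi,\\ R_4(X,Y)Z&=g(Y,Z)hX-g(X,Z)hY+g(hY,Z)X-g(hX,Z)Y,\\ R_7(X,Y)Z&=g(Y,Z)\phi hX-g(X,Z)\phi hY+g(\phi hY,Z)X-g(\phi hX,Z)Y. \end{aligned}$$ -/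

import Mathlib

open Bundle Manifold Module FiberBundle VectorField
open scoped ContDiff Topology

/-- A smooth Riemannian metric `g` on the smooth manifold `M` (without boundary, modelled on `E`):
`g.inner x u v` is `g(u, v)` for tangent vectors `u v` at `x`. -/
abbrev SmoothRiemannianMetric (E : Type*) [NormedAddCommGroup E] [NormedSpace ℝ E]
    (M : Type*) [TopologicalSpace M] [ChartedSpace E M] [IsManifold 𝓘(ℝ, E) ∞ M] :=
  ContMDiffRiemannianMetric 𝓘(ℝ, E) ∞ E (TangentSpace 𝓘(ℝ, E) : M → Type _)

section LeviCivita

variable {E : Type*} [NormedAddCommGroup E] [NormedSpace ℝ E]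
  {M : Type*} [TopologicalSpace M] [ChartedSpace E M] [IsManifold 𝓘(ℝ, E) ∞ M]

namespace SmoothRiemannianMetric

/-! ### The Levi-Civita connection, built from the Koszul formula -/

theorem mdifferentiableAt_inner (g : SmoothRiemannianMetric E M)
    {X Y : Π x : M, TangentSpace 𝓘(ℝ, E) x} {x : M}
    (hX : MDiffAt (T% X) x) (hY : MDiffAt (T% Y) x) :
    MDiffAt (fun y ↦ g.inner y (X y) (Y y)) x := by
  have h := MDifferentiableAt.clm_bundle_apply₂ (F₁ := E) (F₂ := E) (F₃ := ℝ)
    (E₁ := (TangentSpace 𝓘(ℝ, E) : M → Type _)) (E₂ := (TangentSpace 𝓘(ℝ, E) : M → Type _))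
    (E₃ := Bundle.Trivial M ℝ) (b := fun y : M ↦ y)
    ((g.contMDiff x).mdifferentiableAt (by simp)) hX hY
  simp only [mdifferentiableAt_totalSpace] at h
  exact h.2

/-- The Koszul expression
`X g(Y, Z) + Y g(X, Z) - Z g(X, Y) + g([X, Y], Z) - g([X, Z], Y) - g([Y, Z], X)` at `x`. -/
noncomputable def koszul (g : SmoothRiemannianMetric E M)
    (X Y Z : Π x : M, TangentSpace 𝓘(ℝ, E) x) (x : M) : ℝ :=
  mvfderiv 𝓘(ℝ, E) (fun y ↦ g.inner y (Y y) (Z y)) x (X x)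
  + mvfderiv 𝓘(ℝ, E) (fun y ↦ g.inner y (X y) (Z y)) x (Y x)
  - mvfderiv 𝓘(ℝ, E) (fun y ↦ g.inner y (X y) (Y y)) x (Z x)
  + g.inner x (mlieBracket 𝓘(ℝ, E) X Y x) (Z x)
  - g.inner x (mlieBracket 𝓘(ℝ, E) X Z x) (Y x)
  - g.inner x (mlieBracket 𝓘(ℝ, E) Y Z x) (X x)

theorem inner_injective (g : SmoothRiemannianMetric E M) (x : M) :
    Function.Injective (g.inner x).toLinearMap := by
  rw [← LinearMap.ker_eq_bot, LinearMap.ker_eq_bot']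
  intro v hv
  by_contra h
  have h1 := g.pos x v h
  have h2 : g.inner x v = 0 := hv
  simp [h2] at h1

theorem eq_of_inner_eq (g : SmoothRiemannianMetric E M) {x : M} {u v : TangentSpace 𝓘(ℝ, E) x}
    (h : ∀ w, g.inner x u w = g.inner x v w) : u = v :=
  g.inner_injective x (ContinuousLinearMap.ext h)

variable [FiniteDimensional ℝ E]

instance (x : M) : FiniteDimensional ℝ (TangentSpace 𝓘(ℝ, E) x) :=
  inferInstanceAs (FiniteDimensional ℝ E)

instance (x : M) : T2Space (TangentSpace 𝓘(ℝ, E) x) :=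
  inferInstanceAs (T2Space E)

theorem koszul_tensorial_left (g : SmoothRiemannianMetric E M)
    {Y Z : Π x : M, TangentSpace 𝓘(ℝ, E) x} {x : M}
    (hY : MDiffAt (T% Y) x) (hZ : MDiffAt (T% Z) x) :
    TensorialAt 𝓘(ℝ, E) E (fun X ↦ koszul g X Y Z x) x where
  smul {f X} hf hX := by
    have e (Z : Π x : M, TangentSpace 𝓘(ℝ, E) x) : (fun y ↦ g.inner y ((f • X) y) (Z y)) =
        fun y ↦ f y * g.inner y (X y) (Z y) := by
      ext y; simp
    simp only [koszul, e, mvfderiv_fun_mul hf (g.mdifferentiableAt_inner hX hZ),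
      mvfderiv_fun_mul hf (g.mdifferentiableAt_inner hX hY), mlieBracket_smul_left hf hX]
    simp
    ring
  add {X X'} hX hX' := by
    have e (Z : Π x : M, TangentSpace 𝓘(ℝ, E) x) : (fun y ↦ g.inner y ((X + X') y) (Z y)) =
        fun y ↦ g.inner y (X y) (Z y) + g.inner y (X' y) (Z y) := by
      ext y; simp
    simp only [koszul, e,
      mvfderiv_fun_add (g.mdifferentiableAt_inner hX hZ) (g.mdifferentiableAt_inner hX' hZ),
      mvfderiv_fun_add (g.mdifferentiableAt_inner hX hY) (g.mdifferentiableAt_inner hX' hY),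
      mlieBracket_add_left hX hX']
    simp
    ring

theorem koszul_tensorial_right (g : SmoothRiemannianMetric E M)
    {X Y : Π x : M, TangentSpace 𝓘(ℝ, E) x} {x : M}
    (hX : MDiffAt (T% X) x) (hY : MDiffAt (T% Y) x) :
    TensorialAt 𝓘(ℝ, E) E (fun Z ↦ koszul g X Y Z x) x where
  smul {f Z} hf hZ := by
    have e (X : Π x : M, TangentSpace 𝓘(ℝ, E) x) : (fun y ↦ g.inner y (X y) ((f • Z) y)) =
        fun y ↦ f y * g.inner y (X y) (Z y) := by
      ext y; simp
    simp only [koszul, e, mvfderiv_fun_mul hf (g.mdifferentiableAt_inner hX hZ),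
      mvfderiv_fun_mul hf (g.mdifferentiableAt_inner hY hZ), mlieBracket_smul_right hf hZ]
    simp [g.symm x (Z x) (X x), g.symm x (Z x) (Y x)]
    ring
  add {Z Z'} hZ hZ' := by
    have e (X : Π x : M, TangentSpace 𝓘(ℝ, E) x) : (fun y ↦ g.inner y (X y) ((Z + Z') y)) =
        fun y ↦ g.inner y (X y) (Z y) + g.inner y (X y) (Z' y) := by
      ext y; simp
    simp only [koszul, e,
      mvfderiv_fun_add (g.mdifferentiableAt_inner hX hZ) (g.mdifferentiableAt_inner hX hZ'),
      mvfderiv_fun_add (g.mdifferentiableAt_inner hY hZ) (g.mdifferentiableAt_inner hY hZ'),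
      mlieBracket_add_right hZ hZ']
    simp
    ring

theorem koszul_add (g : SmoothRiemannianMetric E M)
    {X Y Y' Z : Π x : M, TangentSpace 𝓘(ℝ, E) x} {x : M} (hX : MDiffAt (T% X) x)
    (hY : MDiffAt (T% Y) x) (hY' : MDiffAt (T% Y') x) (hZ : MDiffAt (T% Z) x) :
    koszul g X (Y + Y') Z x = koszul g X Y Z x + koszul g X Y' Z x := by
  have e1 : (fun y ↦ g.inner y ((Y + Y') y) (Z y)) =
      fun y ↦ g.inner y (Y y) (Z y) + g.inner y (Y' y) (Z y) := by
    ext y; simp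
  have e2 : (fun y ↦ g.inner y (X y) ((Y + Y') y)) =
      fun y ↦ g.inner y (X y) (Y y) + g.inner y (X y) (Y' y) := by
    ext y; simp
  simp only [koszul, e1, e2,
    mvfderiv_fun_add (g.mdifferentiableAt_inner hX hY) (g.mdifferentiableAt_inner hX hY'),
    mvfderiv_fun_add (g.mdifferentiableAt_inner hY hZ) (g.mdifferentiableAt_inner hY' hZ),
    mlieBracket_add_right hY hY', mlieBracket_add_left hY hY']
  simp
  ring

theorem koszul_smul (g : SmoothRiemannianMetric E M)
    {X Y Z : Π x : M, TangentSpace 𝓘(ℝ, E) x} {f : M → ℝ} {x : M} (hX : MDiffAt (T% X) x)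
    (hf : MDiffAt f x) (hY : MDiffAt (T% Y) x) (hZ : MDiffAt (T% Z) x) :
    koszul g X (f • Y) Z x =
      f x * koszul g X Y Z x + 2 * mvfderiv 𝓘(ℝ, E) f x (X x) * g.inner x (Y x) (Z x) := by
  have e1 : (fun y ↦ g.inner y ((f • Y) y) (Z y)) = fun y ↦ f y * g.inner y (Y y) (Z y) := by
    ext y; simp
  have e2 : (fun y ↦ g.inner y (X y) ((f • Y) y)) = fun y ↦ f y * g.inner y (X y) (Y y) := by
    ext y; simp
  simp only [koszul, e1, e2, mvfderiv_fun_mul hf (g.mdifferentiableAt_inner hX hY),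
    mvfderiv_fun_mul hf (g.mdifferentiableAt_inner hY hZ), mlieBracket_smul_right hf hY,
    mlieBracket_smul_left hf hY]
  simp [g.symm x (Y x) (X x)]
  ring

/-- The musical isomorphism `u ↦ g(u, ·)` from the tangent space at `x` onto its dual. -/
noncomputable def flat (g : SmoothRiemannianMetric E M) (x : M) :
    TangentSpace 𝓘(ℝ, E) x ≃ₗ[ℝ] (TangentSpace 𝓘(ℝ, E) x →L[ℝ] ℝ) :=
  LinearEquiv.ofInjectiveOfFinrankEq (g.inner x).toLinearMap (g.inner_injective x) (by
    have h : finrank ℝ (TangentSpace 𝓘(ℝ, E) x →ₗ[ℝ] ℝ) =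
        finrank ℝ (TangentSpace 𝓘(ℝ, E) x →L[ℝ] ℝ) :=
      LinearEquiv.finrank_eq LinearMap.toContinuousLinearMap
    rw [← h]
    exact (Subspace.dual_finrank_eq (K := ℝ) (V := TangentSpace 𝓘(ℝ, E) x)).symm)

theorem inner_flat_symm (g : SmoothRiemannianMetric E M) (x : M)
    (a : TangentSpace 𝓘(ℝ, E) x →L[ℝ] ℝ) (v : TangentSpace 𝓘(ℝ, E) x) :
    g.inner x ((g.flat x).symm a) v = a v := by
  change g.flat x ((g.flat x).symm a) v = a v
  rw [LinearEquiv.apply_symm_apply]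

open scoped Classical in
/-- The endomorphism `u ↦ ∇_u Y` of the tangent space at `x`: the unique one with
`2 g(∇_u Y, w) = koszul X Y Z x` whenever `X`, `Z` are vector fields, differentiable at `x`, with
`X x = u` and `Z x = w`. If `Y` is not differentiable at `x`, the value is `0`. -/
noncomputable def nabla (g : SmoothRiemannianMetric E M) (Y : Π x : M, TangentSpace 𝓘(ℝ, E) x)
    (x : M) : TangentSpace 𝓘(ℝ, E) x →L[ℝ] TangentSpace 𝓘(ℝ, E) x :=
  if hY : MDiffAt (T% Y) x then
    LinearMap.toContinuousLinearMap ((g.flat x).symm.toLinearMap ∘ₗ ((1 / 2 : ℝ) •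
      (TensorialAt.mkHom₂ (fun X Z ↦ g.koszul X Y Z x) x
        (fun _ hZ ↦ g.koszul_tensorial_left hY hZ)
        (fun _ hX ↦ g.koszul_tensorial_right hX hY)).toLinearMap))
  else 0

theorem inner_nabla (g : SmoothRiemannianMetric E M)
    {X Y Z : Π x : M, TangentSpace 𝓘(ℝ, E) x} {x : M}
    (hX : MDiffAt (T% X) x) (hY : MDiffAt (T% Y) x) (hZ : MDiffAt (T% Z) x) :
    g.inner x (g.nabla Y x (X x)) (Z x) = 1 / 2 * g.koszul X Y Z x := by
  rw [nabla, dif_pos hY]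
  have h := TensorialAt.mkHom₂_apply (Φ := fun X Z ↦ g.koszul X Y Z x)
    (fun _ hZ ↦ g.koszul_tensorial_left hY hZ) (fun _ hX ↦ g.koszul_tensorial_right hX hY) hX hZ
  simp only [← h]
  exact g.inner_flat_symm x _ (Z x)

/-- The Levi-Civita connection of `g`: `g.leviCivita Y x (X x)` is `∇_X Y` at `x`. -/
noncomputable def leviCivita (g : SmoothRiemannianMetric E M) :
    CovariantDerivative 𝓘(ℝ, E) E (TangentSpace 𝓘(ℝ, E) : M → Type _) where
  toFun := g.nabla
  isCovariantDerivativeOnUniv :=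
    { add := by
        intro Y Y' x hY hY' _
        ext u
        refine g.eq_of_inner_eq fun w ↦ ?_
        have hU := mdifferentiableAt_extend 𝓘(ℝ, E) E u
        have hW := mdifferentiableAt_extend 𝓘(ℝ, E) E w
        have h1 := g.inner_nabla hU (mdifferentiableAt_add_section hY hY') hW
        have h2 := g.inner_nabla hU hY hW
        have h3 := g.inner_nabla hU hY' hW
        have h4 := g.koszul_add hU hY hY' hW
        simp only [extend_apply_self] at h1 h2 h3
        simp [h1, h2, h3, h4]
        ring
      leibniz := by
        intro Y f x hY hf _
        ext u
        refine g.eq_of_inner_eq fun w ↦ ?_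
        have hU := mdifferentiableAt_extend 𝓘(ℝ, E) E u
        have hW := mdifferentiableAt_extend 𝓘(ℝ, E) E w
        have h1 := g.inner_nabla hU (hf.smul_section hY) hW
        have h2 := g.inner_nabla hU hY hW
        have h4 := g.koszul_smul hU hf hY hW
        simp only [extend_apply_self] at h1 h2 h4
        simp [h1, h2, h4]
        ring }

/-- The Levi-Civita connection is torsion free. -/
theorem leviCivita_torsion (g : SmoothRiemannianMetric E M) : g.leviCivita.torsion = 0 := by
  rw [CovariantDerivative.torsion_eq_zero_iff]
  intro X Y x hX hY
  refine g.eq_of_inner_eq fun w ↦ ?_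
  have hW := mdifferentiableAt_extend 𝓘(ℝ, E) E w
  have h1 := g.inner_nabla hX hY hW
  have h2 := g.inner_nabla hY hX hW
  have e : (fun y ↦ g.inner y (Y y) (X y)) = fun y ↦ g.inner y (X y) (Y y) := by
    ext y; exact g.symm ..
  simp only [koszul, extend_apply_self, e, mlieBracket_swap_apply (V := Y) (W := X)] at h1 h2
  change g.inner x (g.nabla Y x (X x) - g.nabla X x (Y x)) w = _
  simp only [map_sub, sub_apply, h1, h2, map_neg, neg_apply]
  ring

/-- The Levi-Civita connection is compatible with the metric. -/
theorem leviCivita_metric (g : SmoothRiemannianMetric E M)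
    {X Y Z : Π x : M, TangentSpace 𝓘(ℝ, E) x} {x : M}
    (hX : MDiffAt (T% X) x) (hY : MDiffAt (T% Y) x) (hZ : MDiffAt (T% Z) x) :
    mvfderiv 𝓘(ℝ, E) (fun y ↦ g.inner y (Y y) (Z y)) x (X x) =
      g.inner x (g.leviCivita Y x (X x)) (Z x) + g.inner x (Y x) (g.leviCivita Z x (X x)) := by
  have h1 := g.inner_nabla hX hY hZ
  have h2 := g.inner_nabla hX hZ hY
  have e : (fun y ↦ g.inner y (Z y) (Y y)) = fun y ↦ g.inner y (Y y) (Z y) := by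
    ext y; exact g.symm ..
  change _ = g.inner x (g.nabla Y x (X x)) (Z x) + g.inner x (Y x) (g.nabla Z x (X x))
  rw [g.symm x (Y x), h1, h2]
  simp only [koszul, e, mlieBracket_swap_apply (V := Z) (W := Y), map_neg, neg_apply]
  ring

/-- The curvature `R(X, Y)Z = ∇_X ∇_Y Z - ∇_Y ∇_X Z - ∇_[X, Y] Z` of vector fields, at `x`. -/
noncomputable def curvatureField (g : SmoothRiemannianMetric E M)
    (X Y Z : Π x : M, TangentSpace 𝓘(ℝ, E) x) (x : M) : TangentSpace 𝓘(ℝ, E) x :=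
  g.leviCivita (fun y ↦ g.leviCivita Z y (Y y)) x (X x)
    - g.leviCivita (fun y ↦ g.leviCivita Z y (X y)) x (Y x)
    - g.leviCivita Z x (mlieBracket 𝓘(ℝ, E) X Y x)

/-- The curvature tensor `R(u, v)w` on tangent vectors at `x`. As `R` is a tensor, it is evaluated
on tangent vectors by extending them to vector fields that are smooth around `x`. -/
noncomputable def curvature (g : SmoothRiemannianMetric E M) (x : M)
    (u v w : TangentSpace 𝓘(ℝ, E) x) : TangentSpace 𝓘(ℝ, E) x :=
  g.curvatureField (extend E u) (extend E v) (extend E w) x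

end SmoothRiemannianMetric

end LeviCivita

/-- An almost contact metric structure `(φ, ξ, η, g)` on the smooth manifold `M`. -/
structure AlmostContactMetricStructure (E : Type*) [NormedAddCommGroup E] [NormedSpace ℝ E]
    (M : Type*) [TopologicalSpace M] [ChartedSpace E M] [IsManifold 𝓘(ℝ, E) ∞ M] where
  /-- the Riemannian metric -/
  g : SmoothRiemannianMetric E M
  /-- the `(1,1)`-tensor field -/
  phi (x : M) : TangentSpace 𝓘(ℝ, E) x →L[ℝ] TangentSpace 𝓘(ℝ, E) x
  /-- the structure vector field -/
  xi (x : M) : TangentSpace 𝓘(ℝ, E) x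
  /-- the `1`-form -/
  eta (x : M) : TangentSpace 𝓘(ℝ, E) x →L[ℝ] ℝ
  contMDiff_phi : ContMDiff 𝓘(ℝ, E) (𝓘(ℝ, E).prod 𝓘(ℝ, E →L[ℝ] E)) ∞
    (fun x ↦ TotalSpace.mk' (E →L[ℝ] E)
      (E := fun x : M ↦ TangentSpace 𝓘(ℝ, E) x →L[ℝ] TangentSpace 𝓘(ℝ, E) x) x (phi x))
  contMDiff_xi : ContMDiff 𝓘(ℝ, E) (𝓘(ℝ, E).prod 𝓘(ℝ, E)) ∞
    (fun x ↦ TotalSpace.mk' E (E := (TangentSpace 𝓘(ℝ, E) : M → Type _)) x (xi x))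
  contMDiff_eta : ContMDiff 𝓘(ℝ, E) (𝓘(ℝ, E).prod 𝓘(ℝ, E →L[ℝ] ℝ)) ∞
    (fun x ↦ TotalSpace.mk' (E →L[ℝ] ℝ)
      (E := fun x : M ↦ TangentSpace 𝓘(ℝ, E) x →L[ℝ] Bundle.Trivial M ℝ x) x (eta x))
  eta_xi (x : M) : eta x (xi x) = 1
  phi_phi (x : M) (u : TangentSpace 𝓘(ℝ, E) x) : phi x (phi x u) = -u + eta x u • xi x
  inner_phi_phi (x : M) (u v : TangentSpace 𝓘(ℝ, E) x) :
    g.inner x (phi x u) (phi x v) = g.inner x u v - eta x u * eta x v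

namespace AlmostContactMetricStructure

section Structure

variable {E : Type*} [NormedAddCommGroup E] [NormedSpace ℝ E]
  {M : Type*} [TopologicalSpace M] [ChartedSpace E M] [IsManifold 𝓘(ℝ, E) ∞ M]

/-- `dη(X, Y) = (X η(Y) - Y η(X) - η([X, Y])) / 2` at `x`. The factor `1/2` is the convention of
contact metric geometry, the one for which `∇_X ξ = -φX - φhX` on a contact metric manifold. -/
noncomputable def dEta (S : AlmostContactMetricStructure E M)
    (X Y : Π x : M, TangentSpace 𝓘(ℝ, E) x) (x : M) : ℝ :=
  1 / 2 * (mvfderiv 𝓘(ℝ, E) (fun y ↦ S.eta y (Y y)) x (X x)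
    - mvfderiv 𝓘(ℝ, E) (fun y ↦ S.eta y (X y)) x (Y x)
    - S.eta x (mlieBracket 𝓘(ℝ, E) X Y x))

/-- The fundamental `2`-form `Φ(u, v) = g(u, φv)`. -/
noncomputable def fundamentalForm (S : AlmostContactMetricStructure E M) (x : M)
    (u v : TangentSpace 𝓘(ℝ, E) x) : ℝ :=
  S.g.inner x u (S.phi x v)

/-- A contact metric structure: `dη = Φ`. -/
def IsContactMetric (S : AlmostContactMetricStructure E M) : Prop :=
  ∀ (x : M) (X Y : Π x : M, TangentSpace 𝓘(ℝ, E) x), MDiffAt (T% X) x → MDiffAt (T% Y) x →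
    S.dEta X Y x = S.fundamentalForm x (X x) (Y x)

theorem mdifferentiableAt_phi (S : AlmostContactMetricStructure E M)
    {X : Π x : M, TangentSpace 𝓘(ℝ, E) x} {x : M} (hX : MDiffAt (T% X) x) :
    MDiffAt (T% (fun y ↦ S.phi y (X y))) x :=
  MDifferentiableAt.clm_bundle_apply (F₁ := E) (F₂ := E)
    (E₁ := (TangentSpace 𝓘(ℝ, E) : M → Type _)) (E₂ := (TangentSpace 𝓘(ℝ, E) : M → Type _))
    (b := fun y : M ↦ y) ((S.contMDiff_phi x).mdifferentiableAt (by simp)) hX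

/-- The Lie derivative `(L_ξ φ)X = [ξ, φX] - φ[ξ, X]` at `x`. -/
noncomputable def lieDerivPhi (S : AlmostContactMetricStructure E M)
    (X : Π x : M, TangentSpace 𝓘(ℝ, E) x) (x : M) : TangentSpace 𝓘(ℝ, E) x :=
  mlieBracket 𝓘(ℝ, E) S.xi (fun y ↦ S.phi y (X y)) x
    - S.phi x (mlieBracket 𝓘(ℝ, E) S.xi X x)

variable [FiniteDimensional ℝ E]

theorem lieDerivPhi_tensorial (S : AlmostContactMetricStructure E M) (x : M) :
    TensorialAt 𝓘(ℝ, E) E (fun X ↦ S.lieDerivPhi X x) x where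
  smul {f X} hf hX := by
    have e : (fun y ↦ S.phi y ((f • X) y)) = f • fun y ↦ S.phi y (X y) := by
      ext y; simp
    simp only [lieDerivPhi, e, mlieBracket_smul_right hf hX,
      mlieBracket_smul_right hf (S.mdifferentiableAt_phi hX), map_add, map_smul]
    module
  add {X X'} hX hX' := by
    have e : (fun y ↦ S.phi y ((X + X') y)) =
        (fun y ↦ S.phi y (X y)) + fun y ↦ S.phi y (X' y) := by
      ext y; simp
    simp only [lieDerivPhi, e, mlieBracket_add_right hX hX',
      mlieBracket_add_right (S.mdifferentiableAt_phi hX) (S.mdifferentiableAt_phi hX'), map_add]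
    module

/-- The tensor field `h = (1/2) L_ξ φ`. -/
noncomputable def h (S : AlmostContactMetricStructure E M) (x : M) :
    TangentSpace 𝓘(ℝ, E) x →L[ℝ] TangentSpace 𝓘(ℝ, E) x :=
  (1 / 2 : ℝ) • TensorialAt.mkHom (fun X ↦ S.lieDerivPhi X x) x (S.lieDerivPhi_tensorial x)

/-- A `(κ, μ, ν)`-contact metric manifold: a contact metric manifold such that
`R(X, Y)ξ = κ(η(Y)X - η(X)Y) + μ(η(Y)hX - η(X)hY) + ν(η(Y)φhX - η(X)φhY)`
for the smooth functions `κ`, `μ`, `ν`. -/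
structure IsKappaMuNuContactMetric (S : AlmostContactMetricStructure E M) (κ μ ν : M → ℝ) :
    Prop where
  isContactMetric : S.IsContactMetric
  contMDiff_kappa : ContMDiff 𝓘(ℝ, E) 𝓘(ℝ, ℝ) ∞ κ
  contMDiff_mu : ContMDiff 𝓘(ℝ, E) 𝓘(ℝ, ℝ) ∞ μ
  contMDiff_nu : ContMDiff 𝓘(ℝ, E) 𝓘(ℝ, ℝ) ∞ ν
  curvature_xi (x : M) (u v : TangentSpace 𝓘(ℝ, E) x) :
    S.g.curvature x u v (S.xi x) =
      κ x • (S.eta x v • u - S.eta x u • v)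
      + μ x • (S.eta x v • S.h x u - S.eta x u • S.h x v)
      + ν x • (S.eta x v • S.phi x (S.h x u) - S.eta x u • S.phi x (S.h x v))

/-- `F` is the `φ`-sectional curvature: for every `φ`-section, spanned at a point `x` by a unit
vector `u` orthogonal to `ξ` and by `φu`, one has `g(R(u, φu)φu, u) = F(x)`. -/
def IsPhiSectionalCurvature (S : AlmostContactMetricStructure E M) (F : M → ℝ) : Prop :=
  ∀ (x : M) (u : TangentSpace 𝓘(ℝ, E) x), S.g.inner x u u = 1 → S.g.inner x u (S.xi x) = 0 →
    S.g.inner x (S.g.curvature x u (S.phi x u) (S.phi x u)) u = F x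

end Structure

section Tensors

variable {E : Type*} [NormedAddCommGroup E] [NormedSpace ℝ E]
  {M : Type*} [TopologicalSpace M] [ChartedSpace E M] [IsManifold 𝓘(ℝ, E) ∞ M]
  (S : AlmostContactMetricStructure E M)

/-- `R₁(u, v)w = g(v, w)u - g(u, w)v`. -/
noncomputable def R₁ (x : M) (u v w : TangentSpace 𝓘(ℝ, E) x) : TangentSpace 𝓘(ℝ, E) x :=
  S.g.inner x v w • u - S.g.inner x u w • v

/-- `R₃(u, v)w = η(u)η(w)v - η(v)η(w)u + g(u, w)η(v)ξ - g(v, w)η(u)ξ`. -/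
noncomputable def R₃ (x : M) (u v w : TangentSpace 𝓘(ℝ, E) x) : TangentSpace 𝓘(ℝ, E) x :=
  (S.eta x u * S.eta x w) • v - (S.eta x v * S.eta x w) • u
    + (S.g.inner x u w * S.eta x v) • S.xi x - (S.g.inner x v w * S.eta x u) • S.xi x

variable [FiniteDimensional ℝ E]

/-- `R₄(u, v)w = g(v, w)hu - g(u, w)hv + g(hv, w)u - g(hu, w)v`. -/
noncomputable def R₄ (x : M) (u v w : TangentSpace 𝓘(ℝ, E) x) : TangentSpace 𝓘(ℝ, E) x :=
  S.g.inner x v w • S.h x u - S.g.inner x u w • S.h x v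
    + S.g.inner x (S.h x v) w • u - S.g.inner x (S.h x u) w • v

/-- `R₇(u, v)w = g(v, w)φhu - g(u, w)φhv + g(φhv, w)u - g(φhu, w)v`. -/
noncomputable def R₇ (x : M) (u v w : TangentSpace 𝓘(ℝ, E) x) : TangentSpace 𝓘(ℝ, E) x :=
  S.g.inner x v w • S.phi x (S.h x u) - S.g.inner x u w • S.phi x (S.h x v)
    + S.g.inner x (S.phi x (S.h x v)) w • u - S.g.inner x (S.phi x (S.h x u)) w • v

end Tensors

end AlmostContactMetricStructure

/-! In dimension three a tensor with the symmetries of a curvature tensor is determined by its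
values with third argument `ξ` and by a single number `g(R(e, φe)φe, e)`, where `e`, `φe`, `ξ` is an
orthonormal basis; this is `eq_zero_of_curvature_symmetries`. It is applied to the difference of `R`
and the claimed expression.

Write `T = μh + νφh` (`hComb`). The claimed expression depends on `h` only through `T`, and it has
the curvature symmetries once `T` is self-adjoint. This, and the fact that `T` maps into `ker η`, is
read off from the symmetries of `R` itself, applied to `R(u, ξ)ξ`. With `Tξ = 0`, both sides then
agree when the third argument is `ξ`. The contact condition gives `hφ = -φh`, so `T` is trace free
on `ker η`, and the claimed expression has value `F` on every φ-section. Taking `F` from one section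
at each point yields the formula, and the formula shows that the choice of section was immaterial.

The symmetries of `R` are derived for the connection given by the Koszul formula, which requires its
smoothness, the action of brackets on functions and the Jacobi identity. -/

/-! ### Linearity of the local extension of vectors -/

namespace FiberBundle

variable {B F : Type*} [TopologicalSpace B] [NormedAddCommGroup F] [NormedSpace ℝ F]
  {V : B → Type*} [TopologicalSpace (TotalSpace F V)] [(x : B) → AddCommGroup (V x)]
  [(x : B) → Module ℝ (V x)] [(x : B) → TopologicalSpace (V x)] [FiberBundle F V]
  [VectorBundle ℝ F V]

/-- The extension is constant in the trivialization at `x`, which is fibrewise linear over its base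
set; this yields the identity near `x`, and germs are all that the curvature at `x` sees. -/
theorem extend_add {x : B} (u v : V x) :
    ∀ᶠ y in 𝓝 x, extend F (u + v) y = extend F u y + extend F v y := by
  have hx := mem_baseSet_trivializationAt' (F := F) (E := V) x
  have h := ((trivializationAt F V x).continuousLinearMapAt ℝ x).map_add u v
  simp only [(trivializationAt F V x).continuousLinearMapAt_apply_of_mem ℝ hx] at h
  filter_upwards [(trivializationAt F V x).open_baseSet.mem_nhds hx] with y hy
  simp only [extend, h, ← (trivializationAt F V x).symmL_apply (R := ℝ) hy, map_add]

theorem extend_smul {x : B} (a : ℝ) (u : V x) :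
    ∀ᶠ y in 𝓝 x, extend F (a • u) y = a • extend F u y := by
  have hx := mem_baseSet_trivializationAt' (F := F) (E := V) x
  have h := ((trivializationAt F V x).continuousLinearMapAt ℝ x).map_smul a u
  simp only [(trivializationAt F V x).continuousLinearMapAt_apply_of_mem ℝ hx] at h
  filter_upwards [(trivializationAt F V x).open_baseSet.mem_nhds hx] with y hy
  simp only [extend, h, ← (trivializationAt F V x).symmL_apply (R := ℝ) hy, map_smul]

end FiberBundle

/-! ### Smooth functions, vector fields and brackets -/

namespace SmoothRiemannianMetric

variable {E : Type*} [NormedAddCommGroup E] [NormedSpace ℝ E]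
  {M : Type*} [TopologicalSpace M] [ChartedSpace E M] [IsManifold 𝓘(ℝ, E) ∞ M]

theorem contMDiffAt_inner (g : SmoothRiemannianMetric E M)
    {X Y : Π x : M, TangentSpace 𝓘(ℝ, E) x} {x : M}
    (hX : CMDiffAt ∞ (T% X) x) (hY : CMDiffAt ∞ (T% Y) x) :
    CMDiffAt ∞ (fun y ↦ g.inner y (X y) (Y y)) x := by
  have h := ContMDiffAt.clm_bundle_apply₂ (F₁ := E) (F₂ := E) (F₃ := ℝ)
    (E₁ := (TangentSpace 𝓘(ℝ, E) : M → Type _)) (E₂ := (TangentSpace 𝓘(ℝ, E) : M → Type _))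
    (E₃ := Bundle.Trivial M ℝ) (b := fun y : M ↦ y)
    (g.contMDiff x) hX hY
  simp only [contMDiffAt_totalSpace] at h
  exact h.2

theorem inner_self_ne_zero (g : SmoothRiemannianMetric E M) {x : M} {v : TangentSpace 𝓘(ℝ, E) x}
    (hv : v ≠ 0) : g.inner x v v ≠ 0 :=
  (g.pos x v hv).ne'

end SmoothRiemannianMetric

section VectorFields

variable {E : Type*} [NormedAddCommGroup E] [NormedSpace ℝ E]
  {M : Type*} [TopologicalSpace M] [ChartedSpace E M] [IsManifold 𝓘(ℝ, E) ∞ M]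
  {X Y Z : Π x : M, TangentSpace 𝓘(ℝ, E) x} {f : M → ℝ} {x : M}

theorem ContMDiffAt.eventually_mdifferentiableAt_section (hX : CMDiffAt ∞ (T% X) x) :
    ∀ᶠ y in 𝓝 x, MDiffAt (T% X) y :=
  ((contMDiffAt_iff_contMDiffAt_nhds (by simp)).1 (hX.of_le (m := 1) (by simp))).mono
    fun _ h ↦ h.mdifferentiableAt one_ne_zero

theorem ContMDiffAt.eventually_mdifferentiableAt_real (hf : CMDiffAt ∞ f x) :
    ∀ᶠ y in 𝓝 x, MDiffAt f y :=
  ((contMDiffAt_iff_contMDiffAt_nhds (by simp)).1 (hf.of_le (m := 1) (by simp))).mono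
    fun _ h ↦ h.mdifferentiableAt one_ne_zero

theorem ContMDiffAt.mlieBracket_smooth [CompleteSpace E]
    (hX : CMDiffAt ∞ (T% X) x) (hY : CMDiffAt ∞ (T% Y) x) :
    CMDiffAt ∞ (T% (mlieBracket 𝓘(ℝ, E) X Y)) x := by
  have : IsManifold 𝓘(ℝ, E) (((⊤ : ℕ∞) : ℕ∞ω) + 1) M := by simpa
  have : IsManifold 𝓘(ℝ, E) (minSmoothness ℝ 2) M := by
    rw [minSmoothness_of_isRCLikeNormedField]; infer_instance
  exact ContMDiffAt.mlieBracket_vectorField (m := ⊤) (n := ⊤) hX hY (by simp)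

theorem mlieBracket_jacobi [CompleteSpace E] (hX : CMDiffAt ∞ (T% X) x)
    (hY : CMDiffAt ∞ (T% Y) x) (hZ : CMDiffAt ∞ (T% Z) x) :
    mlieBracket 𝓘(ℝ, E) X (mlieBracket 𝓘(ℝ, E) Y Z) x =
      mlieBracket 𝓘(ℝ, E) (mlieBracket 𝓘(ℝ, E) X Y) Z x
        + mlieBracket 𝓘(ℝ, E) Y (mlieBracket 𝓘(ℝ, E) X Z) x := by
  have : IsManifold 𝓘(ℝ, E) (minSmoothness ℝ 3) M := by
    rw [minSmoothness_of_isRCLikeNormedField]; exact .of_le (n := ∞) ENat.LEInfty.out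
  have h2 : minSmoothness ℝ 2 ≤ (∞ : ℕ∞ω) := by
    rw [minSmoothness_of_isRCLikeNormedField]; exact ENat.LEInfty.out
  exact leibniz_identity_mlieBracket_apply (hX.of_le h2) (hY.of_le h2) (hZ.of_le h2)

theorem eventuallyEq_mlieBracket_smul_right [CompleteSpace E]
    (X : Π x : M, TangentSpace 𝓘(ℝ, E) x) (hf : CMDiffAt ∞ f x) (hY : CMDiffAt ∞ (T% Y) x) :
    mlieBracket 𝓘(ℝ, E) X (f • Y) =ᶠ[𝓝 x]
      (fun y ↦ mvfderiv 𝓘(ℝ, E) f y (X y)) • Y + f • mlieBracket 𝓘(ℝ, E) X Y := by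
  filter_upwards [hf.eventually_mdifferentiableAt_real, hY.eventually_mdifferentiableAt_section]
    with y hfy hYy
  rw [mlieBracket_smul_right hfy hYy]
  rfl

end VectorFields

namespace SmoothRiemannianMetric

variable {E : Type*} [NormedAddCommGroup E] [NormedSpace ℝ E] [FiniteDimensional ℝ E]
  {M : Type*} [TopologicalSpace M] [ChartedSpace E M] [IsManifold 𝓘(ℝ, E) ∞ M]
  {X Y Z : Π x : M, TangentSpace 𝓘(ℝ, E) x} {f : M → ℝ} {x : M}

/-- Smoothness of `Xf` is borrowed from that of brackets: `[X, fW] - f[X, W] = (Xf)W`, and for `W`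
nonzero at `x` the factor `Xf` is recovered by pairing with `W` and dividing by `g(W, W)`. -/
theorem contMDiffAt_mvfderiv_apply (g : SmoothRiemannianMetric E M) (hf : CMDiffAt ∞ f x)
    (hX : CMDiffAt ∞ (T% X) x) : CMDiffAt ∞ (fun y ↦ mvfderiv 𝓘(ℝ, E) f y (X y)) x := by
  have := FiniteDimensional.complete ℝ E
  rcases subsingleton_or_nontrivial E with hE | hE
  · have e : (fun y ↦ mvfderiv 𝓘(ℝ, E) f y (X y)) = fun _ ↦ 0 := by
      ext y
      have : X y = 0 := hE.elim (α := E) _ _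
      simp [this]
    rw [e]
    exact contMDiffAt_const
  obtain ⟨w, hw⟩ := exists_ne (0 : E)
  let W : Π x : M, TangentSpace 𝓘(ℝ, E) x := extend E (x := x) w
  have hW : CMDiffAt ∞ (T% W) x := contMDiffAt_extend ..
  have hWx : W x = w := extend_apply_self ..
  have h1 : CMDiffAt ∞ (T% ((fun y ↦ mvfderiv 𝓘(ℝ, E) f y (X y)) • W)) x := by
    refine ((hX.mlieBracket_smooth (hf.smul_section hW)).sub_section
      (hf.smul_section (hX.mlieBracket_smooth hW))).congr_of_eventuallyEq ?_
    filter_upwards [eventuallyEq_mlieBracket_smul_right X hf hW] with y hy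
    simp [hy]
  have h2 := g.contMDiffAt_inner h1 hW
  have h3 := g.contMDiffAt_inner hW hW
  have h0 : g.inner x (W x) (W x) ≠ 0 := g.inner_self_ne_zero (by rw [hWx]; exact hw)
  refine (h2.div₀ h3 h0).congr_of_eventuallyEq ?_
  filter_upwards [h3.continuousAt.eventually_ne h0] with y hy
  simp [hy]

/-- Jacobi for `X`, `Y`, `fW` minus `f` times Jacobi for `X`, `Y`, `W`: the first-order terms
`(Yf)[X, W] + (Xf)[Y, W]` are symmetric in `X` and `Y` and cancel. What remains is the identity
times `W`, with `W` nonzero at `x`. -/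
theorem mvfderiv_mlieBracket (g : SmoothRiemannianMetric E M) (hf : CMDiffAt ∞ f x)
    (hX : CMDiffAt ∞ (T% X) x) (hY : CMDiffAt ∞ (T% Y) x) :
    mvfderiv 𝓘(ℝ, E) f x (mlieBracket 𝓘(ℝ, E) X Y x) =
      mvfderiv 𝓘(ℝ, E) (fun y ↦ mvfderiv 𝓘(ℝ, E) f y (Y y)) x (X x)
        - mvfderiv 𝓘(ℝ, E) (fun y ↦ mvfderiv 𝓘(ℝ, E) f y (X y)) x (Y x) := by
  have := FiniteDimensional.complete ℝ E
  rcases subsingleton_or_nontrivial E with hE | hE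
  · have h0 (v : TangentSpace 𝓘(ℝ, E) x) : v = 0 := hE.elim (α := E) _ _
    rw [h0 (mlieBracket 𝓘(ℝ, E) X Y x), h0 (X x), h0 (Y x)]
    simp
  obtain ⟨w, hw⟩ := exists_ne (0 : E)
  let W : Π x : M, TangentSpace 𝓘(ℝ, E) x := extend E (x := x) w
  have hW : CMDiffAt ∞ (T% W) x := contMDiffAt_extend ..
  have hWx : W x = w := extend_apply_self ..
  have md {Z : Π x : M, TangentSpace 𝓘(ℝ, E) x} (hZ : CMDiffAt ∞ (T% Z) x) : MDiffAt (T% Z) x :=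
    hZ.mdifferentiableAt (by simp)
  have hfd : MDiffAt f x := hf.mdifferentiableAt (by simp)
  have second {X Y : Π x : M, TangentSpace 𝓘(ℝ, E) x} (hX : CMDiffAt ∞ (T% X) x)
      (hY : CMDiffAt ∞ (T% Y) x) : mlieBracket 𝓘(ℝ, E) X (mlieBracket 𝓘(ℝ, E) Y (f • W)) x =
        mvfderiv 𝓘(ℝ, E) (fun y ↦ mvfderiv 𝓘(ℝ, E) f y (Y y)) x (X x) • W x
        + mvfderiv 𝓘(ℝ, E) f x (Y x) • mlieBracket 𝓘(ℝ, E) X W x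
        + mvfderiv 𝓘(ℝ, E) f x (X x) • mlieBracket 𝓘(ℝ, E) Y W x
        + f x • mlieBracket 𝓘(ℝ, E) X (mlieBracket 𝓘(ℝ, E) Y W) x := by
    have hYf := g.contMDiffAt_mvfderiv_apply hf hY
    have hYW := hY.mlieBracket_smooth hW
    rw [(Filter.EventuallyEq.refl _ X).mlieBracket_vectorField_eq
      (eventuallyEq_mlieBracket_smul_right Y hf hW),
      mlieBracket_add_right (md (hYf.smul_section hW)) (md (hf.smul_section hYW)),
      mlieBracket_smul_right (hYf.mdifferentiableAt (by simp)) (md hW),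
      mlieBracket_smul_right hfd (md hYW)]
    module
  have h := mlieBracket_jacobi hX hY (hf.smul_section hW)
  have h' := mlieBracket_jacobi hX hY hW
  rw [second hX hY, second hY hX, mlieBracket_smul_right hfd (md hW), h'] at h
  have h2 : (mvfderiv 𝓘(ℝ, E) f x (mlieBracket 𝓘(ℝ, E) X Y x) -
      (mvfderiv 𝓘(ℝ, E) (fun y ↦ mvfderiv 𝓘(ℝ, E) f y (Y y)) x (X x)
        - mvfderiv 𝓘(ℝ, E) (fun y ↦ mvfderiv 𝓘(ℝ, E) f y (X y)) x (Y x))) • W x = 0 := by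
    rw [← sub_eq_zero] at h
    rw [← neg_zero, ← h]
    module
  rcases smul_eq_zero.1 h2 with h3 | h3
  · exact sub_eq_zero.1 h3
  · exact absurd h3 (by rw [hWx]; exact hw)

end SmoothRiemannianMetric

/-! ### Smoothness of the Levi-Civita connection -/

namespace SmoothRiemannianMetric

variable {E : Type*} [NormedAddCommGroup E] [NormedSpace ℝ E] [FiniteDimensional ℝ E]
  {M : Type*} [TopologicalSpace M] [ChartedSpace E M] [IsManifold 𝓘(ℝ, E) ∞ M]
  {X Y Z : Π x : M, TangentSpace 𝓘(ℝ, E) x} {f : M → ℝ} {x : M}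

theorem contMDiffAt_koszul (g : SmoothRiemannianMetric E M) (hX : CMDiffAt ∞ (T% X) x)
    (hY : CMDiffAt ∞ (T% Y) x) (hZ : CMDiffAt ∞ (T% Z) x) :
    CMDiffAt ∞ (fun y ↦ g.koszul X Y Z y) x := by
  have := FiniteDimensional.complete ℝ E
  unfold koszul
  exact ((((((g.contMDiffAt_mvfderiv_apply (g.contMDiffAt_inner hY hZ) hX).add
    (g.contMDiffAt_mvfderiv_apply (g.contMDiffAt_inner hX hZ) hY)).sub
    (g.contMDiffAt_mvfderiv_apply (g.contMDiffAt_inner hX hY) hZ)).add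
    (g.contMDiffAt_inner (hX.mlieBracket_smooth hY) hZ)).sub
    (g.contMDiffAt_inner (hX.mlieBracket_smooth hZ) hY)).sub
    (g.contMDiffAt_inner (hY.mlieBracket_smooth hZ) hX))

/-- A vector field whose inner products with all smooth vector fields are smooth is smooth. -/
theorem contMDiffAt_of_inner (g : SmoothRiemannianMetric E M)
    (h : ∀ Z : Π x : M, TangentSpace 𝓘(ℝ, E) x, CMDiffAt ∞ (T% Z) x →
      CMDiffAt ∞ (fun y ↦ g.inner y (X y) (Z y)) x) : CMDiffAt ∞ (T% X) x := by
  classical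
  let e := trivializationAt E (TangentSpace 𝓘(ℝ, E) : M → Type _) x
  have hx : x ∈ e.baseSet := mem_baseSet_trivializationAt' x
  let b := Module.finBasis ℝ E
  let s := e.localFrame b
  have hs (i) : CMDiffAt ∞ (T% (s i)) x := contMDiffAt_localFrame_of_mem ∞ e b i hx
  rw [contMDiffAt_iff_localFrameCoeff (e := e) b hx]
  let c : M → (Fin (finrank ℝ E) → ℝ) := fun y i ↦ e.localFrameCoeff 𝓘(ℝ, E) b i y (X y)
  let K : M → (Fin (finrank ℝ E) → ℝ) := fun y j ↦ g.inner y (X y) (s j y)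
  let T : Fin (finrank ℝ E) → Fin (finrank ℝ E) →
      (Fin (finrank ℝ E) → ℝ) →L[ℝ] (Fin (finrank ℝ E) → ℝ) := fun i j ↦
    (ContinuousLinearMap.proj i).smulRight (Pi.single j 1)
  -- `A y` is the Gram matrix of the frame. It carries the coefficients `c` of `X` to the inner
  -- products `K`, so `c` is smooth because `A` and `K` are and inversion is smooth at an invertible
  -- operator.
  let A : M → (Fin (finrank ℝ E) → ℝ) →L[ℝ] (Fin (finrank ℝ E) → ℝ) := fun y ↦
    ∑ i, ∑ j, g.inner y (s i y) (s j y) • T i j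
  have hA_apply (y) (a : Fin (finrank ℝ E) → ℝ) (j) :
      A y a j = g.inner y (∑ i, a i • s i y) (s j y) := by
    simp [A, T, Finset.sum_apply, Pi.single_apply, mul_comm]
  have hA : ContMDiffAt 𝓘(ℝ, E) 𝓘(ℝ, (Fin (finrank ℝ E) → ℝ) →L[ℝ] (Fin (finrank ℝ E) → ℝ)) ∞ A x :=
    ContMDiffAt.sum fun i _ ↦ ContMDiffAt.sum fun j _ ↦
      (g.contMDiffAt_inner (hs i) (hs j)).smul contMDiffAt_const
  have hK : ContMDiffAt 𝓘(ℝ, E) 𝓘(ℝ, Fin (finrank ℝ E) → ℝ) ∞ K x :=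
    contMDiffAt_pi_space.2 fun j ↦ h _ (hs j)
  have hinj (y) (hy : y ∈ e.baseSet) : Function.Injective (A y) := by
    rw [injective_iff_map_eq_zero]
    intro a ha
    -- A combination of frame vectors with coefficients in the kernel of `A y` is orthogonal to
    -- every frame vector, hence to itself.
    have h0 : ∑ i, a i • s i y = 0 := by
      by_contra hne
      refine g.inner_self_ne_zero hne ?_
      conv_lhs => rw [map_sum (g.inner y (∑ i, a i • s i y))]
      refine Finset.sum_eq_zero fun j _ ↦ ?_
      rw [map_smul, ← hA_apply, ha]
      simp
    have hli := (e.basisAt b hy).linearIndependent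
    rw [Fintype.linearIndependent_iff] at hli
    ext i
    refine hli a ?_ i
    simpa [s, hy] using h0
  have hinv (y) (hy : y ∈ e.baseSet) : (A y).IsInvertible :=
    ⟨(LinearEquiv.ofInjectiveEndo (A y).toLinearMap (hinj y hy)).toContinuousLinearEquiv, rfl⟩
  have hAc (y) (hy : y ∈ e.baseSet) : A y (c y) = K y := by
    ext j
    rw [hA_apply, ← e.eq_sum_localFrameCoeff_smul hy]
  have hc : ContMDiffAt 𝓘(ℝ, E) 𝓘(ℝ, Fin (finrank ℝ E) → ℝ) ∞ c x := by
    have h1 : ContMDiffAt 𝓘(ℝ, E) 𝓘(ℝ, Fin (finrank ℝ E) → ℝ) ∞ (fun y ↦ (A y).inverse (K y)) x := by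
      refine ContMDiffAt.clm_apply ?_ hK
      obtain ⟨B, hB⟩ := hinv x hx
      have h2 := contDiffAt_map_inverse (n := ∞) B
      rw [hB] at h2
      exact h2.contMDiffAt.comp x hA
    refine h1.congr_of_eventuallyEq ?_
    filter_upwards [e.open_baseSet.mem_nhds hx] with y hy
    rw [← hAc y hy, eq_comm, (hinv y hy).inverse_apply_eq]
  exact fun i ↦ contMDiffAt_pi_space.1 hc i

/-- Against a smooth `Z` the inner product is half the Koszul expression near `x`, hence smooth. -/
theorem contMDiffAt_leviCivita (g : SmoothRiemannianMetric E M) (hX : CMDiffAt ∞ (T% X) x)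
    (hY : CMDiffAt ∞ (T% Y) x) : CMDiffAt ∞ (T% (fun y ↦ g.leviCivita Y y (X y))) x := by
  refine g.contMDiffAt_of_inner fun Z hZ ↦ ?_
  refine ((contMDiffAt_const (c := (1 / 2 : ℝ))).mul
    (g.contMDiffAt_koszul hX hY hZ)).congr_of_eventuallyEq ?_
  filter_upwards [hX.eventually_mdifferentiableAt_section, hY.eventually_mdifferentiableAt_section,
    hZ.eventually_mdifferentiableAt_section] with y h1 h2 h3
  exact g.inner_nabla h1 h2 h3

end SmoothRiemannianMetric

theorem Filter.EventuallyEq.mvfderiv_eq {E : Type*} [NormedAddCommGroup E] [NormedSpace ℝ E]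
    {M : Type*} [TopologicalSpace M] [ChartedSpace E M] {f f' : M → ℝ} {x : M}
    (h : f =ᶠ[𝓝 x] f') : mvfderiv 𝓘(ℝ, E) f x = mvfderiv 𝓘(ℝ, E) f' x := by
  ext v
  exact congrArg (fun L : E →L[ℝ] ℝ ↦ L v) (h.mfderiv_eq (I := 𝓘(ℝ, E)) (I' := 𝓘(ℝ, ℝ)))

/-! ### Curvature of vector fields -/

namespace SmoothRiemannianMetric

variable {E : Type*} [NormedAddCommGroup E] [NormedSpace ℝ E] [FiniteDimensional ℝ E]
  {M : Type*} [TopologicalSpace M] [ChartedSpace E M] [IsManifold 𝓘(ℝ, E) ∞ M]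
  {X X' Y Y' Z Z' : Π x : M, TangentSpace 𝓘(ℝ, E) x} {x : M}

theorem leviCivita_congr (g : SmoothRiemannianMetric E M) (hX : CMDiffAt ∞ (T% X) x)
    (hX' : CMDiffAt ∞ (T% X') x) (h : ∀ᶠ y in 𝓝 x, X y = X' y) :
    g.leviCivita X x = g.leviCivita X' x :=
  g.leviCivita.isCovariantDerivativeOnUniv.congr_of_eventuallyEq
    (hX.mdifferentiableAt (by simp)) (hX'.mdifferentiableAt (by simp)) Filter.univ_mem h

theorem leviCivita_add (g : SmoothRiemannianMetric E M) (hX : MDiffAt (T% X) x)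
    (hX' : MDiffAt (T% X') x) :
    g.leviCivita (X + X') x = g.leviCivita X x + g.leviCivita X' x :=
  g.leviCivita.isCovariantDerivativeOnUniv.add hX hX'

theorem leviCivita_const_smul (g : SmoothRiemannianMetric E M) (a : ℝ) (hX : MDiffAt (T% X) x) :
    g.leviCivita (a • X) x = a • g.leviCivita X x :=
  g.leviCivita.isCovariantDerivativeOnUniv.smul_const a hX

theorem leviCivita_sub_leviCivita (g : SmoothRiemannianMetric E M) (hX : MDiffAt (T% X) x)
    (hY : MDiffAt (T% Y) x) :
    g.leviCivita Y x (X x) - g.leviCivita X x (Y x) = mlieBracket 𝓘(ℝ, E) X Y x :=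
  (CovariantDerivative.torsion_eq_zero_iff _).1 g.leviCivita_torsion hX hY

theorem eventually_leviCivita_congr (g : SmoothRiemannianMetric E M) (hX : CMDiffAt ∞ (T% X) x)
    (hX' : CMDiffAt ∞ (T% X') x) (h : ∀ᶠ y in 𝓝 x, X y = X' y) :
    ∀ᶠ y in 𝓝 x, g.leviCivita X y = g.leviCivita X' y := by
  filter_upwards [hX.eventually_mdifferentiableAt_section,
    hX'.eventually_mdifferentiableAt_section, eventually_eventually_nhds.2 h] with y h1 h2 h3
  exact g.leviCivita.isCovariantDerivativeOnUniv.congr_of_eventuallyEq h1 h2 Filter.univ_mem h3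

/-- Extensions of vectors are additive and homogeneous only near the base point, so linearity of
`curvature` needs the curvature to depend on germs alone. With these extensions, linearity over real
constants suffices. -/
theorem curvatureField_congr (g : SmoothRiemannianMetric E M)
    (hX : CMDiffAt ∞ (T% X) x) (hX' : CMDiffAt ∞ (T% X') x)
    (hY : CMDiffAt ∞ (T% Y) x) (hY' : CMDiffAt ∞ (T% Y') x)
    (hZ : CMDiffAt ∞ (T% Z) x) (hZ' : CMDiffAt ∞ (T% Z') x)
    (eX : ∀ᶠ y in 𝓝 x, X y = X' y) (eY : ∀ᶠ y in 𝓝 x, Y y = Y' y)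
    (eZ : ∀ᶠ y in 𝓝 x, Z y = Z' y) :
    g.curvatureField X Y Z x = g.curvatureField X' Y' Z' x := by
  have key {Y Y' : Π x : M, TangentSpace 𝓘(ℝ, E) x} (hY : CMDiffAt ∞ (T% Y) x)
      (hY' : CMDiffAt ∞ (T% Y') x) (eY : ∀ᶠ y in 𝓝 x, Y y = Y' y) :
      g.leviCivita (fun y ↦ g.leviCivita Z y (Y y)) x
        = g.leviCivita (fun y ↦ g.leviCivita Z' y (Y' y)) x := by
    refine g.leviCivita_congr (g.contMDiffAt_leviCivita hY hZ) (g.contMDiffAt_leviCivita hY' hZ') ?_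
    filter_upwards [eY, g.eventually_leviCivita_congr hZ hZ' eZ] with y h1 h2
    rw [h1, h2]
  simp only [curvatureField, key hX hX' eX, key hY hY' eY, g.leviCivita_congr hZ hZ' eZ,
    eX.self_of_nhds, eY.self_of_nhds, Filter.EventuallyEq.mlieBracket_vectorField_eq eX eY]

theorem curvatureField_swap (g : SmoothRiemannianMetric E M)
    (X Y Z : Π x : M, TangentSpace 𝓘(ℝ, E) x) (x : M) :
    g.curvatureField X Y Z x = -g.curvatureField Y X Z x := by
  simp only [curvatureField, mlieBracket_swap_apply (V := X) (W := Y), map_neg]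
  module

theorem curvatureField_add_left (g : SmoothRiemannianMetric E M) (hX : CMDiffAt ∞ (T% X) x)
    (hX' : CMDiffAt ∞ (T% X') x) (hZ : CMDiffAt ∞ (T% Z) x) :
    g.curvatureField (X + X') Y Z x = g.curvatureField X Y Z x + g.curvatureField X' Y Z x := by
  have e : (fun y ↦ g.leviCivita Z y ((X + X') y)) =
      (fun y ↦ g.leviCivita Z y (X y)) + fun y ↦ g.leviCivita Z y (X' y) := by
    ext y; simp
  simp only [curvatureField]
  rw [e, mlieBracket_add_left (hX.mdifferentiableAt (by simp)) (hX'.mdifferentiableAt (by simp)),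
    g.leviCivita_add ((g.contMDiffAt_leviCivita hX hZ).mdifferentiableAt (by simp))
      ((g.contMDiffAt_leviCivita hX' hZ).mdifferentiableAt (by simp))]
  simp only [Pi.add_apply, map_add, add_apply]
  module

theorem curvatureField_smul_left (g : SmoothRiemannianMetric E M) (a : ℝ)
    (hX : CMDiffAt ∞ (T% X) x) (hZ : CMDiffAt ∞ (T% Z) x) :
    g.curvatureField (a • X) Y Z x = a • g.curvatureField X Y Z x := by
  have e : (fun y ↦ g.leviCivita Z y ((a • X) y)) = a • fun y ↦ g.leviCivita Z y (X y) := by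
    ext y; simp
  simp only [curvatureField]
  rw [e, mlieBracket_const_smul_left (hX.mdifferentiableAt (by simp)),
    g.leviCivita_const_smul a ((g.contMDiffAt_leviCivita hX hZ).mdifferentiableAt (by simp))]
  simp only [Pi.smul_apply, map_smul, smul_apply]
  module

theorem curvatureField_add_right (g : SmoothRiemannianMetric E M) (hX : CMDiffAt ∞ (T% X) x)
    (hY : CMDiffAt ∞ (T% Y) x) (hZ : CMDiffAt ∞ (T% Z) x) (hZ' : CMDiffAt ∞ (T% Z') x) :
    g.curvatureField X Y (Z + Z') x = g.curvatureField X Y Z x + g.curvatureField X Y Z' x := by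
  have key {Y : Π x : M, TangentSpace 𝓘(ℝ, E) x} (hY : CMDiffAt ∞ (T% Y) x) :
      g.leviCivita (fun y ↦ g.leviCivita (Z + Z') y (Y y)) x
        = g.leviCivita (fun y ↦ g.leviCivita Z y (Y y)) x
          + g.leviCivita (fun y ↦ g.leviCivita Z' y (Y y)) x := by
    have h1 := g.contMDiffAt_leviCivita hY hZ
    have h2 := g.contMDiffAt_leviCivita hY hZ'
    rw [← g.leviCivita_add (h1.mdifferentiableAt (by simp)) (h2.mdifferentiableAt (by simp))]
    refine g.leviCivita_congr (g.contMDiffAt_leviCivita hY (hZ.add_section hZ'))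
      (h1.add_section h2) ?_
    filter_upwards [hZ.eventually_mdifferentiableAt_section,
      hZ'.eventually_mdifferentiableAt_section] with y hy hy'
    simp [g.leviCivita_add hy hy']
  simp only [curvatureField, key hX, key hY, g.leviCivita_add (hZ.mdifferentiableAt (by simp))
    (hZ'.mdifferentiableAt (by simp)), add_apply]
  module

/-- Apply `[X, Y]f = XYf - YXf` to `f = g(Z, Z)`. Metric compatibility turns it into `2 g(R(X, Y)Z,
Z) = 0`, the cross terms `g(∇_X Z, ∇_Y Z)` being symmetric. -/
theorem inner_curvatureField_self (g : SmoothRiemannianMetric E M) (hX : CMDiffAt ∞ (T% X) x)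
    (hY : CMDiffAt ∞ (T% Y) x) (hZ : CMDiffAt ∞ (T% Z) x) :
    g.inner x (g.curvatureField X Y Z x) (Z x) = 0 := by
  have := FiniteDimensional.complete ℝ E
  have md {Z : Π x : M, TangentSpace 𝓘(ℝ, E) x} (hZ : CMDiffAt ∞ (T% Z) x) : MDiffAt (T% Z) x :=
    hZ.mdifferentiableAt (by simp)
  have first {Y : Π x : M, TangentSpace 𝓘(ℝ, E) x} {y : M} (hY : MDiffAt (T% Y) y)
      (hZ : MDiffAt (T% Z) y) : mvfderiv 𝓘(ℝ, E) (fun y ↦ g.inner y (Z y) (Z y)) y (Y y) =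
        2 * g.inner y (g.leviCivita Z y (Y y)) (Z y) := by
    rw [g.leviCivita_metric hY hZ hZ, g.symm y (Z y)]
    ring
  have second {X Y : Π x : M, TangentSpace 𝓘(ℝ, E) x} (hX : CMDiffAt ∞ (T% X) x)
      (hY : CMDiffAt ∞ (T% Y) x) :
      mvfderiv 𝓘(ℝ, E) (fun y ↦ mvfderiv 𝓘(ℝ, E) (fun y ↦ g.inner y (Z y) (Z y)) y (Y y)) x (X x) =
        2 * (g.inner x (g.leviCivita (fun y ↦ g.leviCivita Z y (Y y)) x (X x)) (Z x)
          + g.inner x (g.leviCivita Z x (Y x)) (g.leviCivita Z x (X x))) := by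
    have h1 := g.contMDiffAt_leviCivita hY hZ
    have e : (fun y ↦ mvfderiv 𝓘(ℝ, E) (fun y ↦ g.inner y (Z y) (Z y)) y (Y y)) =ᶠ[𝓝 x]
        fun y ↦ g.inner y (((2 : ℝ) • fun y ↦ g.leviCivita Z y (Y y)) y) (Z y) := by
      filter_upwards [hY.eventually_mdifferentiableAt_section,
        hZ.eventually_mdifferentiableAt_section] with y hy hy'
      rw [first hy hy']
      simp
    rw [e.mvfderiv_eq, g.leviCivita_metric (md hX) (md h1.const_smul_section) (md hZ),
      g.leviCivita_const_smul 2 (md h1)]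
    simp
    ring
  have h := g.mvfderiv_mlieBracket (g.contMDiffAt_inner hZ hZ) hX hY
  rw [second hX hY, second hY hX, first (md (hX.mlieBracket_smooth hY)) (md hZ),
    g.symm x (g.leviCivita Z x (X x))] at h
  simp only [curvatureField, map_sub, sub_apply]
  linarith

/-- Zero torsion, used twice, gives `∇_X ∇_Y Z - ∇_X ∇_Z Y - ∇_[Y, Z] X = [X, [Y, Z]]`. The cyclic
sum is the Bianchi sum on the left and vanishes on the right by Jacobi. -/
theorem curvatureField_bianchi (g : SmoothRiemannianMetric E M) (hX : CMDiffAt ∞ (T% X) x)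
    (hY : CMDiffAt ∞ (T% Y) x) (hZ : CMDiffAt ∞ (T% Z) x) :
    g.curvatureField X Y Z x + g.curvatureField Y Z X x + g.curvatureField Z X Y x = 0 := by
  have := FiniteDimensional.complete ℝ E
  have md {Z : Π x : M, TangentSpace 𝓘(ℝ, E) x} (hZ : CMDiffAt ∞ (T% Z) x) : MDiffAt (T% Z) x :=
    hZ.mdifferentiableAt (by simp)
  have key {X Y Z : Π x : M, TangentSpace 𝓘(ℝ, E) x} (hX : CMDiffAt ∞ (T% X) x)
      (hY : CMDiffAt ∞ (T% Y) x) (hZ : CMDiffAt ∞ (T% Z) x) :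
      g.leviCivita (fun y ↦ g.leviCivita Z y (Y y)) x (X x)
        - g.leviCivita (fun y ↦ g.leviCivita Y y (Z y)) x (X x)
        - g.leviCivita X x (mlieBracket 𝓘(ℝ, E) Y Z x)
        = mlieBracket 𝓘(ℝ, E) X (mlieBracket 𝓘(ℝ, E) Y Z) x := by
    have h1 := g.contMDiffAt_leviCivita hY hZ
    have h2 := g.contMDiffAt_leviCivita hZ hY
    have h3 := hY.mlieBracket_smooth hZ
    have e : g.leviCivita (fun y ↦ g.leviCivita Z y (Y y)) x =
        g.leviCivita (mlieBracket 𝓘(ℝ, E) Y Z) x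
          + g.leviCivita (fun y ↦ g.leviCivita Y y (Z y)) x := by
      rw [← g.leviCivita_add (md h3) (md h2)]
      refine g.leviCivita_congr h1 (h3.add_section h2) ?_
      filter_upwards [hY.eventually_mdifferentiableAt_section,
        hZ.eventually_mdifferentiableAt_section] with y hy hy'
      simp [← g.leviCivita_sub_leviCivita hy hy']
    rw [← g.leviCivita_sub_leviCivita (md hX) (md h3), e, add_apply]
    module
  have h1 := key hX hY hZ
  have h2 := key hY hZ hX
  have h3 := key hZ hX hY
  have hj := mlieBracket_jacobi hX hY hZ
  -- The Leibniz form of the Jacobi identity is brought to its cyclic form.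
  rw [mlieBracket_swap_apply (V := mlieBracket 𝓘(ℝ, E) X Y), mlieBracket_swap (V := X) (W := Z),
    ← neg_one_smul ℝ (mlieBracket 𝓘(ℝ, E) Z X),
    mlieBracket_const_smul_right (md (hZ.mlieBracket_smooth hX)), ← h1, ← h2, ← h3,
    ← sub_eq_zero] at hj
  rw [← hj]
  simp only [curvatureField]
  module

/-! ### Symmetries of the curvature tensor -/

theorem curvature_add_left (g : SmoothRiemannianMetric E M)
    (u u' v w : TangentSpace 𝓘(ℝ, E) x) :
    g.curvature x (u + u') v w = g.curvature x u v w + g.curvature x u' v w := by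
  have s (u : TangentSpace 𝓘(ℝ, E) x) : CMDiffAt ∞ (T% (extend E u)) x := contMDiffAt_extend ..
  rw [curvature, curvature, curvature, ← g.curvatureField_add_left (s u) (s u') (s w)]
  exact g.curvatureField_congr (s _) ((s u).add_section (s u')) (s v) (s v) (s w) (s w)
    (extend_add u u') (.of_forall fun _ ↦ rfl) (.of_forall fun _ ↦ rfl)

theorem curvature_smul_left (g : SmoothRiemannianMetric E M) (a : ℝ)
    (u v w : TangentSpace 𝓘(ℝ, E) x) :
    g.curvature x (a • u) v w = a • g.curvature x u v w := by
  have s (u : TangentSpace 𝓘(ℝ, E) x) : CMDiffAt ∞ (T% (extend E u)) x := contMDiffAt_extend ..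
  rw [curvature, curvature, ← g.curvatureField_smul_left a (s u) (s w)]
  exact g.curvatureField_congr (s _) (s u).const_smul_section (s v) (s v) (s w) (s w)
    (extend_smul a u) (.of_forall fun _ ↦ rfl) (.of_forall fun _ ↦ rfl)

theorem curvature_swap (g : SmoothRiemannianMetric E M) (u v w : TangentSpace 𝓘(ℝ, E) x) :
    g.curvature x u v w = -g.curvature x v u w :=
  g.curvatureField_swap ..

theorem curvature_add_right (g : SmoothRiemannianMetric E M)
    (u v w w' : TangentSpace 𝓘(ℝ, E) x) :
    g.curvature x u v (w + w') = g.curvature x u v w + g.curvature x u v w' := by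
  have s (u : TangentSpace 𝓘(ℝ, E) x) : CMDiffAt ∞ (T% (extend E u)) x := contMDiffAt_extend ..
  rw [curvature, curvature, curvature, ← g.curvatureField_add_right (s u) (s v) (s w) (s w')]
  exact g.curvatureField_congr (s u) (s u) (s v) (s v) (s _) ((s w).add_section (s w'))
    (.of_forall fun _ ↦ rfl) (.of_forall fun _ ↦ rfl) (extend_add w w')

theorem inner_curvature_self (g : SmoothRiemannianMetric E M) (u v w : TangentSpace 𝓘(ℝ, E) x) :
    g.inner x (g.curvature x u v w) w = 0 := by
  have s (u : TangentSpace 𝓘(ℝ, E) x) : CMDiffAt ∞ (T% (extend E u)) x := contMDiffAt_extend ..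
  simpa [curvature] using g.inner_curvatureField_self (s u) (s v) (s w)

/-- Polarization of `inner_curvature_self`. -/
theorem inner_curvature_skew (g : SmoothRiemannianMetric E M)
    (u v w z : TangentSpace 𝓘(ℝ, E) x) :
    g.inner x (g.curvature x u v w) z = -g.inner x (g.curvature x u v z) w := by
  have h := g.inner_curvature_self u v (w + z)
  simp only [curvature_add_right, map_add, add_apply, inner_curvature_self] at h
  linarith

theorem curvature_bianchi (g : SmoothRiemannianMetric E M) (u v w : TangentSpace 𝓘(ℝ, E) x) :
    g.curvature x u v w + g.curvature x v w u + g.curvature x w u v = 0 :=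
  g.curvatureField_bianchi (contMDiffAt_extend ..) (contMDiffAt_extend ..) (contMDiffAt_extend ..)

theorem inner_curvature_pair (g : SmoothRiemannianMetric E M)
    (u v w z : TangentSpace 𝓘(ℝ, E) x) :
    g.inner x (g.curvature x u v w) z = g.inner x (g.curvature x w z u) v := by
  have b (a b c d : TangentSpace 𝓘(ℝ, E) x) : g.inner x (g.curvature x a b c) d
      + g.inner x (g.curvature x b c a) d + g.inner x (g.curvature x c a b) d = 0 := by
    simpa using congrArg (fun t ↦ g.inner x t d) (g.curvature_bianchi a b c)
  have s (a b c d : TangentSpace 𝓘(ℝ, E) x) : g.inner x (g.curvature x a b c) d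
      = -g.inner x (g.curvature x b a c) d := by
    rw [g.curvature_swap a b c]; simp
  have k := g.inner_curvature_skew (x := x)
  -- The classical octahedron argument: four Bianchi identities are combined, and the two skew
  -- symmetries identify their terms.
  linarith [b u v w z, b v w z u, b w z u v, b z u v w, k u v w z, k v w u z, k w u v z, k v w z u,
    k w z v u, k z v w u, k w z u v, k z u w v, k u w z v, k z u v w, k u v z w, k v z u w,
    s u v w z, s w u v z, s z v w u, s w z u v, s v z u w, s u w z v]

end SmoothRiemannianMetric

/-- In dimension three, a tensor with the symmetries of a curvature tensor vanishes if it vanishes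
as soon as its third argument is `t`, and on the plane spanned by `e` and `f`. -/
theorem eq_zero_of_curvature_symmetries {V : Type*} [AddCommGroup V] [Module ℝ V]
    {D : V → V → V → V → ℝ} (hadd : ∀ u u' v w z, D (u + u') v w z = D u v w z + D u' v w z)
    (hsmul : ∀ (a : ℝ) u v w z, D (a • u) v w z = a * D u v w z)
    (hswap : ∀ u v w z, D u v w z = -D v u w z) (hskew : ∀ u v w z, D u v w z = -D u v z w)
    (hpair : ∀ u v w z, D u v w z = D w z u v) {e f t : V}
    (hspan : ∀ u, ∃ a b c : ℝ, u = a • e + b • f + c • t) (ht : ∀ u v z, D u v t z = 0)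
    (hef : D e f f e = 0) (u v w z : V) : D u v w z = 0 := by
  have ht1 (v w z) : D t v w z = 0 := by rw [hpair, ht]
  have exp1 (a b c : ℝ) (v w z) :
      D (a • e + b • f + c • t) v w z = a * D e v w z + b * D f v w z := by
    simp [hadd, hsmul, ht1]
  have exp2 (a b c : ℝ) (u w z) :
      D u (a • e + b • f + c • t) w z = a * D u e w z + b * D u f w z := by
    rw [hswap, exp1, hswap u e, hswap u f]; ring
  -- Expanded over `e` and `f`, the last two slots contribute only multiples of `D e f f e`.
  have plane (w z) : D e f w z = 0 := by
    have h1 (u w) : D u w e e = 0 := by linarith [hskew u w e e]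
    have h2 (u w) : D u w f f = 0 := by linarith [hskew u w f f]
    have h3 : D e f e f = 0 := by rw [hskew, hef, neg_zero]
    obtain ⟨a, b, c, rfl⟩ := hspan w
    obtain ⟨a', b', c', rfl⟩ := hspan z
    rw [hpair, exp1, exp2, exp2, hpair e e, hpair f f, h1, h2, h3, hpair f e, hef]
    ring
  obtain ⟨a, b, c, rfl⟩ := hspan u
  obtain ⟨a', b', c', rfl⟩ := hspan v
  have h1 (u w z) : D u u w z = 0 := by linarith [hswap u u w z]
  rw [exp1, exp2, exp2, h1, h1, plane, hswap f e, plane]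
  ring

/-! ### Almost contact metric algebra -/

namespace AlmostContactMetricStructure

variable {E : Type*} [NormedAddCommGroup E] [NormedSpace ℝ E]
  {M : Type*} [TopologicalSpace M] [ChartedSpace E M] [IsManifold 𝓘(ℝ, E) ∞ M]
  (S : AlmostContactMetricStructure E M) {x : M}

theorem xi_ne_zero : S.xi x ≠ 0 := by
  intro h
  have := S.eta_xi x
  simp [h] at this

-- Since `φ²ξ = 0`, the formula for `φ²` at `φξ` gives `φξ = η(φξ)ξ`. Applying `φ` again gives
-- `η(φξ)φξ = 0`, and either factor vanishing forces `η(φξ) = 0`.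
@[simp]
theorem phi_xi : S.phi x (S.xi x) = 0 := by
  have h2 : S.phi x (S.phi x (S.xi x)) = 0 := by simp [S.phi_phi, S.eta_xi]
  have h3 := S.phi_phi x (S.phi x (S.xi x))
  rw [h2, map_zero, eq_comm, neg_add_eq_zero] at h3
  have h4 := h2
  rw [h3, map_smul] at h4
  have h5 : S.eta x (S.phi x (S.xi x)) = 0 :=
    (smul_eq_zero.1 h4).elim id fun h ↦ by rw [h, map_zero]
  rw [h3, h5, zero_smul]

-- Computing `φ³u` as `φ(φ²u)` and as `φ²(φu)` leaves `η(φu)ξ = 0`.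
@[simp]
theorem eta_phi (u : TangentSpace 𝓘(ℝ, E) x) : S.eta x (S.phi x u) = 0 := by
  have h1 := S.phi_phi x (S.phi x u)
  rw [S.phi_phi x u, map_add, map_neg, map_smul, phi_xi, smul_zero, add_zero,
    left_eq_add] at h1
  exact (smul_eq_zero.1 h1).resolve_right S.xi_ne_zero

theorem inner_xi (u : TangentSpace 𝓘(ℝ, E) x) : S.g.inner x u (S.xi x) = S.eta x u := by
  have h := S.inner_phi_phi x u (S.xi x)
  simp only [phi_xi, map_zero, S.eta_xi] at h
  linarith

theorem mdifferentiableAt_eta {X : Π x : M, TangentSpace 𝓘(ℝ, E) x} (hX : MDiffAt (T% X) x) :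
    MDiffAt (fun y ↦ S.eta y (X y)) x := by
  have h := MDifferentiableAt.clm_bundle_apply (F₁ := E) (F₂ := ℝ)
    (E₁ := (TangentSpace 𝓘(ℝ, E) : M → Type _)) (E₂ := Bundle.Trivial M ℝ)
    (b := fun y : M ↦ y) ((S.contMDiff_eta x).mdifferentiableAt (by simp)) hX
  simp only [mdifferentiableAt_totalSpace] at h
  exact h.2

theorem mdifferentiableAt_xi : MDiffAt (T% S.xi) x :=
  (S.contMDiff_xi x).mdifferentiableAt (by simp)

/-- On a contact metric manifold `(L_ξ φ)φ + φ(L_ξ φ) = 0`. -/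
theorem IsContactMetric.lieDerivPhi_phi {S : AlmostContactMetricStructure E M}
    (hS : S.IsContactMetric) [CompleteSpace E] {X : Π x : M, TangentSpace 𝓘(ℝ, E) x}
    (hX : MDiffAt (T% X) x) :
    S.lieDerivPhi (fun y ↦ S.phi y (X y)) x = -S.phi x (S.lieDerivPhi X x) := by
  -- The contact condition is used only through `dη(ξ, X) = g(ξ, φX) = 0`. As `η(ξ) = 1`, this says
  -- `ξ(η(X)) = η([ξ, X])`, which cancels the `ξ`-components produced by the two occurrences of
  -- `φ²`.
  have hd := hS x S.xi X S.mdifferentiableAt_xi hX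
  have e1 : (fun y ↦ S.eta y (S.xi y)) = fun _ ↦ 1 := funext S.eta_xi
  simp only [dEta, fundamentalForm, e1, mvfderiv_const, zero_apply, sub_zero,
    S.g.symm x (S.xi x), inner_xi, eta_phi] at hd
  have e2 : (fun y ↦ S.phi y (S.phi y (X y))) =
      (-1 : ℝ) • X + (fun y ↦ S.eta y (X y)) • S.xi := by
    ext y
    simp [S.phi_phi]
  have hη := S.mdifferentiableAt_eta hX
  simp only [lieDerivPhi, e2]
  rw [mlieBracket_add_right (hX.smul_const_section (a := (-1 : ℝ))) (hη.smul_section S.mdifferentiableAt_xi),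
    mlieBracket_const_smul_right hX, mlieBracket_smul_right hη S.mdifferentiableAt_xi,
    map_sub, S.phi_phi, mlieBracket_self]
  have h0 : mvfderiv 𝓘(ℝ, E) (fun y ↦ S.eta y (X y)) x (S.xi x)
      = S.eta x (mlieBracket 𝓘(ℝ, E) S.xi X x) := by linarith
  simp only [h0, Pi.zero_apply]
  module

/-- On `ker η` one has `φ² = -1` and `φ` is isometric, so `g(u, φu) = g(φu, φ²u) = -g(φu, u)`. -/
theorem inner_phi_self {u : TangentSpace 𝓘(ℝ, E) x} (hu : S.eta x u = 0) :
    S.g.inner x u (S.phi x u) = 0 := by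
  have h := S.inner_phi_phi x u (S.phi x u)
  rw [S.phi_phi, hu, S.g.symm x (S.phi x u)] at h
  simp only [zero_smul, add_zero, map_neg, neg_apply, zero_mul, sub_zero] at h
  linarith

/-- In dimension three, a unit vector `e` orthogonal to `ξ` gives the basis `e`, `φe`, `ξ`. -/
theorem exists_eq_phi_basis (hE : finrank ℝ E = 3) {e : TangentSpace 𝓘(ℝ, E) x}
    (he : S.g.inner x e e = 1) (hη : S.eta x e = 0) (u : TangentSpace 𝓘(ℝ, E) x) :
    ∃ a b c : ℝ, u = a • e + b • S.phi x e + c • S.xi x := by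
  have hep := S.inner_phi_self hη
  have hpp : S.g.inner x (S.phi x e) (S.phi x e) = 1 := by
    rw [S.inner_phi_phi, he, hη]; ring
  have hli : LinearIndependent ℝ ![e, S.phi x e, S.xi x] := by
    rw [Fintype.linearIndependent_iff]
    intro c hc
    simp only [Fin.sum_univ_three, Matrix.cons_val] at hc
    -- The three vectors are orthonormal, so pairing with `e` and `φe` and applying `η` isolates
    -- each coefficient.
    have h1 := congrArg (fun t ↦ S.g.inner x t e) hc
    have h2 := congrArg (fun t ↦ S.g.inner x t (S.phi x e)) hc
    have h3 := congrArg (S.eta x) hc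
    simp only [map_add, map_smul, add_apply, smul_apply, he, hep, hpp, S.g.symm x (S.phi x e) e,
      S.g.symm x (S.xi x), inner_xi, hη, eta_phi, S.eta_xi, smul_eq_mul, map_zero,
      zero_apply] at h1 h2 h3
    intro i
    fin_cases i
    · simpa using h1
    · simpa using h2
    · simpa using h3
  have h3 : finrank ℝ (TangentSpace 𝓘(ℝ, E) x) = 3 := hE
  let B := basisOfLinearIndependentOfCardEqFinrank hli (by simp [h3])
  refine ⟨B.repr u 0, B.repr u 1, B.repr u 2, ?_⟩
  have h := B.sum_repr u
  simpa [B, Fin.sum_univ_three] using h.symm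

/-! ### The operators `h` and `μh + νφh` -/

variable [FiniteDimensional ℝ E]

theorem h_apply {X : Π x : M, TangentSpace 𝓘(ℝ, E) x} (hX : MDiffAt (T% X) x) :
    S.h x (X x) = (1 / 2 : ℝ) • S.lieDerivPhi X x := by
  simp only [h, smul_apply]
  rw [TensorialAt.mkHom_apply (S.lieDerivPhi_tensorial x) hX]

@[simp]
theorem h_xi : S.h x (S.xi x) = 0 := by
  rw [S.h_apply S.mdifferentiableAt_xi]
  have e : (fun y ↦ S.phi y (S.xi y)) = 0 := funext fun y ↦ S.phi_xi
  rw [lieDerivPhi, e]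
  simp

theorem IsContactMetric.h_phi {S : AlmostContactMetricStructure E M} (hS : S.IsContactMetric)
    (u : TangentSpace 𝓘(ℝ, E) x) : S.h x (S.phi x u) = -S.phi x (S.h x u) := by
  have := FiniteDimensional.complete ℝ E
  have hU := mdifferentiableAt_extend 𝓘(ℝ, E) E u
  have h1 := S.h_apply (S.mdifferentiableAt_phi hU)
  have h2 := S.h_apply hU
  rw [extend_apply_self] at h1 h2
  rw [h1, h2, hS.lieDerivPhi_phi hU, map_smul, smul_neg]

/-- The operator `μh + νφh`. -/
noncomputable def hComb (a b : ℝ) (x : M) :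
    TangentSpace 𝓘(ℝ, E) x →L[ℝ] TangentSpace 𝓘(ℝ, E) x :=
  a • S.h x + b • (S.phi x).comp (S.h x)

theorem hComb_apply (a b : ℝ) (u : TangentSpace 𝓘(ℝ, E) x) :
    S.hComb a b x u = a • S.h x u + b • S.phi x (S.h x u) := rfl

theorem hComb_xi (a b : ℝ) : S.hComb a b x (S.xi x) = 0 := by
  simp [hComb_apply]

/-- `μh + νφh` is trace free on the contact distribution. -/
theorem IsContactMetric.inner_hComb_phi {S : AlmostContactMetricStructure E M}
    (hS : S.IsContactMetric) (a b : ℝ) {u : TangentSpace 𝓘(ℝ, E) x} (hu : S.eta x u = 0) :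
    S.g.inner x (S.hComb a b x (S.phi x u)) (S.phi x u) = -S.g.inner x (S.hComb a b x u) u := by
  simp only [hComb_apply, hS.h_phi, map_neg, map_add, map_smul, add_apply, neg_apply, smul_apply,
    S.inner_phi_phi, hu, smul_eq_mul]
  ring

/-- The contact distribution contains a unit vector. -/
theorem exists_unit (hE : finrank ℝ E = 3) (x : M) :
    ∃ e : TangentSpace 𝓘(ℝ, E) x, S.g.inner x e e = 1 ∧ S.eta x e = 0 := by
  have hr := (S.eta x).toLinearMap.finrank_range_add_finrank_ker
  have h3 : finrank ℝ (TangentSpace 𝓘(ℝ, E) x) = 3 := hE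
  have h1 : finrank ℝ (S.eta x).toLinearMap.range ≤ 1 := by
    simpa using Submodule.finrank_le (S.eta x).toLinearMap.range
  have hk : 0 < finrank ℝ (S.eta x).toLinearMap.ker := by omega
  have := finrank_pos_iff.1 hk
  obtain ⟨⟨v, hv⟩, hv0⟩ := exists_ne (0 : (S.eta x).toLinearMap.ker)
  have hv0 : v ≠ 0 := fun h ↦ hv0 (Subtype.ext h)
  have hp := S.g.pos x v hv0
  have hs : √(S.g.inner x v v) ≠ 0 := (Real.sqrt_pos.2 hp).ne'
  refine ⟨(√(S.g.inner x v v))⁻¹ • v, ?_, ?_⟩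
  · simp only [map_smul, smul_apply, smul_eq_mul]
    field_simp
    rw [Real.sq_sqrt hp.le]
  · have : S.eta x v = 0 := hv
    simp [this]

/-- The `(0,4)`-form of `F R₁ + (F - κ) R₃ + μ R₄ + ν R₇`. -/
theorem inner_curvature_formula (F k a b : ℝ) (u v w z : TangentSpace 𝓘(ℝ, E) x) :
    S.g.inner x (F • S.R₁ x u v w + (F - k) • S.R₃ x u v w + a • S.R₄ x u v w
      + b • S.R₇ x u v w) z =
    F * (S.g.inner x v w * S.g.inner x u z - S.g.inner x u w * S.g.inner x v z)
    + (F - k) * (S.eta x u * S.eta x w * S.g.inner x v z - S.eta x v * S.eta x w * S.g.inner x u z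
      + S.g.inner x u w * S.eta x v * S.eta x z - S.g.inner x v w * S.eta x u * S.eta x z)
    + (S.g.inner x v w * S.g.inner x (S.hComb a b x u) z
      - S.g.inner x u w * S.g.inner x (S.hComb a b x v) z
      + S.g.inner x (S.hComb a b x v) w * S.g.inner x u z
      - S.g.inner x (S.hComb a b x u) w * S.g.inner x v z) := by
  simp only [R₁, R₃, R₄, R₇, hComb_apply, map_add, map_sub, map_smul, add_apply, sub_apply,
    smul_apply, smul_eq_mul, S.g.symm x (S.xi x), inner_xi]
  ring

/-! ### What the curvature condition forces on `μh + νφh` -/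

namespace IsKappaMuNuContactMetric

variable {S} {κ μ ν : M → ℝ} (hS : S.IsKappaMuNuContactMetric κ μ ν)
include hS

theorem curvature_xi_eq (u v : TangentSpace 𝓘(ℝ, E) x) :
    S.g.curvature x u v (S.xi x) = κ x • (S.eta x v • u - S.eta x u • v)
      + (S.eta x v • S.hComb (μ x) (ν x) x u - S.eta x u • S.hComb (μ x) (ν x) x v) := by
  rw [hS.curvature_xi]
  simp only [hComb_apply]
  module

/-- The `κ`-part of `R(u, ξ)ξ` is orthogonal to `ξ`, and `g(R(u, ξ)ξ, ξ) = 0`. -/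
theorem eta_hComb (u : TangentSpace 𝓘(ℝ, E) x) : S.eta x (S.hComb (μ x) (ν x) x u) = 0 := by
  have h := S.g.inner_curvature_self u (S.xi x) (S.xi x)
  rw [hS.curvature_xi_eq, inner_xi] at h
  simpa [S.eta_xi, hComb_xi] using h

/-- Pair symmetry makes the Jacobi operator `u ↦ R(u, ξ)ξ` self-adjoint. Its `κ`-part is
self-adjoint as well, so the rest is; the symmetry of `h` and of `φh` separately is not needed. -/
theorem inner_hComb_comm (u v : TangentSpace 𝓘(ℝ, E) x) :
    S.g.inner x (S.hComb (μ x) (ν x) x u) v = S.g.inner x (S.hComb (μ x) (ν x) x v) u := by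
  have h1 := S.g.inner_curvature_pair u (S.xi x) (S.xi x) v
  rw [S.g.curvature_swap (S.xi x) v, map_neg, neg_apply, S.g.inner_curvature_skew v,
    hS.curvature_xi_eq, hS.curvature_xi_eq] at h1
  simp only [S.eta_xi, hComb_xi, map_add, map_sub, map_smul, add_apply, sub_apply,
    smul_apply, smul_eq_mul, S.g.symm x (S.xi x), inner_xi, map_zero, zero_apply,
    S.g.symm x v u] at h1
  linarith

end IsKappaMuNuContactMetric

end AlmostContactMetricStructure

/-! ### The curvature formula -/

theorem corollary3p3
    {E : Type*} [NormedAddCommGroup E] [NormedSpace ℝ E] [FiniteDimensional ℝ E]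
    (hE : Module.finrank ℝ E = 3)
    {M : Type*} [TopologicalSpace M] [ChartedSpace E M] [IsManifold 𝓘(ℝ, E) ∞ M]
    (S : AlmostContactMetricStructure E M) (κ μ ν : M → ℝ)
    (hS : S.IsKappaMuNuContactMetric κ μ ν) (hκ : ∀ x, κ x < 1) :
    ∃ F : M → ℝ, S.IsPhiSectionalCurvature F ∧
      ∀ (x : M) (u v w : TangentSpace 𝓘(ℝ, E) x),
        S.g.curvature x u v w =
          F x • S.R₁ x u v w + (F x - κ x) • S.R₃ x u v w
            + μ x • S.R₄ x u v w + ν x • S.R₇ x u v w := by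
  choose e he hη using S.exists_unit hE
  -- On a φ-section the `R₃` terms vanish with `η`, and the `R₄` and `R₇` terms add up to the trace
  -- of `μh + νφh` on the section, which is zero.
  have section_eq (F : ℝ) {x : M} {u : TangentSpace 𝓘(ℝ, E) x} (hu : S.g.inner x u u = 1)
      (hu0 : S.eta x u = 0) : S.g.inner x (F • S.R₁ x u (S.phi x u) (S.phi x u)
        + (F - κ x) • S.R₃ x u (S.phi x u) (S.phi x u) + μ x • S.R₄ x u (S.phi x u) (S.phi x u)
        + ν x • S.R₇ x u (S.phi x u) (S.phi x u)) u = F := by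
    rw [S.inner_curvature_formula]
    simp only [S.inner_phi_phi, hu, hu0, S.inner_phi_self hu0, S.g.symm x (S.phi x u) u,
      hS.isContactMetric.inner_hComb_phi _ _ hu0, S.eta_phi]
    ring
  -- The unit vector `e x` is an arbitrary choice; independence of it follows from the formula.
  let F : M → ℝ := fun x ↦
    S.g.inner x (S.g.curvature x (e x) (S.phi x (e x)) (S.phi x (e x))) (e x)
  have formula (x : M) (u v w : TangentSpace 𝓘(ℝ, E) x) : S.g.curvature x u v w =
      F x • S.R₁ x u v w + (F x - κ x) • S.R₃ x u v w
        + μ x • S.R₄ x u v w + ν x • S.R₇ x u v w := by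
    refine S.g.eq_of_inner_eq fun z ↦ ?_
    rw [← sub_eq_zero]
    refine eq_zero_of_curvature_symmetries (V := TangentSpace 𝓘(ℝ, E) x)
      (D := fun u v w z ↦ S.g.inner x (S.g.curvature x u v w) z - S.g.inner x
        (F x • S.R₁ x u v w + (F x - κ x) • S.R₃ x u v w
          + μ x • S.R₄ x u v w + ν x • S.R₇ x u v w) z)
      ?_ ?_ ?_ ?_ ?_ (S.exists_eq_phi_basis hE (he x) (hη x)) ?_ ?_ u v w z
    · intro u u' v w z
      simp only [S.inner_curvature_formula]
      simp only [S.g.curvature_add_left, map_add, add_apply]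
      ring
    · intro a u v w z
      simp only [S.inner_curvature_formula]
      simp only [S.g.curvature_smul_left, map_smul, smul_apply,
        smul_eq_mul]
      ring
    · intro u v w z
      simp only [S.inner_curvature_formula]
      simp only [S.g.curvature_swap u v, map_neg, neg_apply]
      ring
    · intro u v w z
      simp only [S.inner_curvature_formula, S.g.inner_curvature_skew u v w]
      ring
    · intro u v w z
      simp only [S.inner_curvature_formula, S.g.inner_curvature_pair u v w]
      -- Pair symmetry of the right-hand side is where self-adjointness of `μh + νφh` enters.
      rw [S.g.symm x w v, S.g.symm x w u, S.g.symm x z u, S.g.symm x z v,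
        hS.inner_hComb_comm w v, hS.inner_hComb_comm w u, hS.inner_hComb_comm z u,
        hS.inner_hComb_comm z v]
      ring
    -- With third argument `ξ` the `F`-terms of `R₁` and `R₃` cancel, leaving the `κ`-term of the
    -- curvature condition.
    · intro u v z
      simp only [S.inner_curvature_formula]
      simp only [hS.curvature_xi_eq, S.inner_xi, S.eta_xi,
        hS.eta_hComb, map_add, map_sub, map_smul, add_apply, sub_apply, smul_apply, smul_eq_mul]
      ring
    -- `F x` was chosen to make this one component agree.
    · exact sub_eq_zero.2 (section_eq _ (he x) (hη x)).symm
  refine ⟨F, fun x u hu hu0 ↦ ?_, formula⟩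
  rw [S.inner_xi] at hu0
  rw [formula, section_eq _ hu hu0]
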